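/- For a Noetherian local ring $(A,\mathfrak m)$ let $\operatorname{edim}(A)$ be the least number of generators of $\mathfrak m$ (equivalently $\dim_{A/\mathfrak m}\mathfrak m/\mathfrak m^2$) and let $\operatorname{cdim}(A):=\operatorname{edim}(A)-\dim(A)$ be its (embedding) codimension, where $\dim$ is the Krull dimension. A Noetherian local ring $A$ is regular if $\operatorname{edim}(A)=\dim(A)$, and a Noetherian ring is regular if its localizations at all prime ideals are regular local rings. Let $R$ be a Noetherian commutative ring and let $X_1,\dots,X_n$ be indeterminates over $R$. Then for every prime ideal $P$ of $R[X_1,\dots,X_n]$, with $p:=P\cap R$, $$\operatorname{cdim}\bigl(R[X_1,\dots,X_n]_P\bigr)=\operatorname{cdim}(R_p).$$ In particular, $R[X_1,\dots,X_n]$ is regular if and only if $R$ is regular. -/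

import Mathlib

/-- The embedding dimension of a Noetherian local ring: the least number of generators of its
maximal ideal. -/
noncomputable def embDim (R : Type*) [CommRing R] [IsLocalRing R] [IsNoetherianRing R] : ℕ :=
  (IsLocalRing.maximalIdeal R).spanFinrank

/-- The embedding dimension is also the dimension of the cotangent space over the residue
field. -/
theorem embDim_eq_finrank_cotangentSpace (R : Type*) [CommRing R] [IsLocalRing R]
    [IsNoetherianRing R] :
    embDim R =
      Module.finrank (IsLocalRing.ResidueField R) (IsLocalRing.CotangentSpace R) :=
  IsLocalRing.spanFinrank_maximalIdeal_eq_finrank_cotangentSpace R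

/-- The Krull dimension of a Noetherian local ring as a natural number; it is finite and not `⊥`
for these rings, so that nothing is lost, see `coe_localDim`. -/
noncomputable def localDim (R : Type*) [CommRing R] [IsLocalRing R] [IsNoetherianRing R] : ℕ :=
  ((ringKrullDim R).unbotD 0).toNat

theorem coe_localDim (R : Type*) [CommRing R] [IsLocalRing R] [IsNoetherianRing R] :
    (localDim R : WithBot ℕ∞) = ringKrullDim R := by
  have h1 : ringKrullDim R ≠ ⊤ := ringKrullDim_ne_top
  have h2 : ringKrullDim R ≠ ⊥ := ringKrullDim_ne_bot
  unfold localDim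
  generalize ringKrullDim R = d at h1 h2
  induction d using WithBot.recBotCoe with
  | bot => exact absurd rfl h2
  | coe a =>
    have ha : a ≠ ⊤ := fun h => h1 (by rw [h]; rfl)
    rw [WithBot.unbotD_coe]
    lift a to ℕ using ha
    rfl

/-- The (embedding) codimension of a Noetherian local ring: its embedding dimension minus its
Krull dimension, as an integer. -/
noncomputable def embCodim (R : Type*) [CommRing R] [IsLocalRing R] [IsNoetherianRing R] : ℤ :=
  (embDim R : ℤ) - (localDim R : ℤ)

/-! Induction on the number of indeterminates reduces to one, and localizing the coefficients at `p`
reduces to a local ring `A` with `P` over its maximal ideal `m`. As `(A/m)[X]` is a PID, either `P =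
mA[X]`, and embedding dimension and height are those of `A`, or `P = mA[X] + (y)` with `y ∉ mA[X]`,
and both grow by one. Embedding dimension is tracked by bases of `I/I²`, which survive extension to
`A[X]`, adjoining `y`, and localization at a prime. Regularity is codimension zero at every prime.
-/

open IsLocalRing

/-! ### Conormal bases and embedding dimension -/

/-- The family `x` generates `I`, and its image in `I / I ^ 2` is a basis over the quotient by
`I`. -/
structure Ideal.IsConormalBasis {S ι : Type*} [CommRing S] [Fintype ι] (I : Ideal S)
    (x : ι → S) : Prop where
  span_eq : Ideal.span (Set.range x) = I
  mem_of_sum_mem : ∀ f : ι → S, ∑ i, f i * x i ∈ I ^ 2 → ∀ i, f i ∈ I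

namespace Ideal.IsConormalBasis

theorem mem {S ι : Type*} [CommRing S] [Fintype ι] {I : Ideal S} {x : ι → S}
    (h : I.IsConormalBasis x) (i : ι) : x i ∈ I :=
  h.span_eq ▸ Ideal.subset_span ⟨i, rfl⟩

/-- Over a local ring, a conormal basis of the maximal ideal has `embDim` elements. -/
theorem embDim_eq_card {A ι : Type*} [CommRing A] [IsLocalRing A] [IsNoetherianRing A] [Fintype ι]
    {x : ι → A} (h : (maximalIdeal A).IsConormalBasis x) : embDim A = Fintype.card ι := by
  apply le_antisymm
  · unfold embDim
    rw [← h.span_eq]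
    refine (Submodule.spanFinrank_span_le_ncard_of_finite (Set.finite_range x)).trans ?_
    rw [← Set.image_univ]
    exact (Set.ncard_image_le Set.finite_univ).trans (by simp [Set.ncard_univ])
  · rw [embDim_eq_finrank_cotangentSpace]
    have hli : LinearIndependent (IsLocalRing.ResidueField A)
        (fun i => (maximalIdeal A).toCotangent ⟨x i, h.mem i⟩ : ι → CotangentSpace A) := by
      rw [Fintype.linearIndependent_iff]
      intro g hg
      choose f hf using fun i => residue_surjective (g i)
      have key : ∀ i, f i ∈ maximalIdeal A := by
        apply h.mem_of_sum_mem
        have h0 : (maximalIdeal A).toCotangent (∑ i, f i • ⟨x i, h.mem i⟩) = 0 := by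
          rw [map_sum, ← hg]
          refine Finset.sum_congr rfl fun i _ => ?_
          rw [← hf i, map_smul]
          rfl
        rw [Ideal.toCotangent_eq_zero] at h0
        simpa using h0
      intro i
      rw [← hf i, residue_eq_zero_iff]
      exact key i
    exact hli.fintype_card_le_finrank

/-- The maximal ideal of a Noetherian local ring has a conormal basis. -/
theorem exists_maximalIdeal (A : Type*) [CommRing A] [IsLocalRing A] [IsNoetherianRing A] :
    ∃ x : Fin (embDim A) → A, (maximalIdeal A).IsConormalBasis x := by
  let b := Module.finBasisOfFinrankEq (IsLocalRing.ResidueField A) (CotangentSpace A)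
    (embDim_eq_finrank_cotangentSpace A).symm
  choose x hx using fun i => (maximalIdeal A).toCotangent_surjective (b i)
  refine ⟨fun i => x i, ?_, fun f hf i => ?_⟩
  · have h1 := CotangentSpace.span_image_eq_top_iff (R := A) (s := Set.range x)
    have h2 : (maximalIdeal A).toCotangent '' Set.range x = Set.range b := by
      rw [← Set.range_comp]
      exact congrArg Set.range (funext hx)
    rw [h2] at h1
    have h3 := congrArg (Submodule.map (maximalIdeal A).subtype) (h1.mp b.span_eq)
    rw [Submodule.map_span, ← Set.range_comp, Submodule.map_top, Submodule.range_subtype] at h3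
    exact h3
  · have h0 : (maximalIdeal A).toCotangent (∑ i, f i • x i) = 0 := by
      rw [Ideal.toCotangent_eq_zero]
      simpa using hf
    have h1 : ∑ i, residue A (f i) • b i = 0 := by
      rw [← h0, map_sum]
      refine Finset.sum_congr rfl fun i _ => ?_
      rw [map_smul, hx]
      rfl
    exact (residue_eq_zero_iff _).mp (Fintype.linearIndependent_iff.mp b.linearIndependent _ h1 i)

/-- A conormal basis of a prime ideal is one of the maximal ideal of the localization. -/
theorem localization_atPrime {S ι : Type*} [CommRing S] [Fintype ι] {P : Ideal S} [P.IsPrime]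
    {x : ι → S} (h : P.IsConormalBasis x) :
    (maximalIdeal (Localization.AtPrime P)).IsConormalBasis
      (fun i => algebraMap S (Localization.AtPrime P) (x i)) := by
  refine ⟨?_, fun f hf i => ?_⟩
  · rw [← Localization.AtPrime.map_eq_maximalIdeal]
    refine Eq.trans ?_ (congrArg (Ideal.map _) h.span_eq)
    rw [Ideal.map_span, ← Set.range_comp]
    rfl
  -- Clear denominators to get a relation over `S`, up to a factor outside the prime `P`.
  · obtain ⟨s, hs⟩ := IsLocalization.exist_integer_multiples_of_finite P.primeCompl f
    choose g hg using hs
    rw [← Localization.AtPrime.map_eq_maximalIdeal] at hf ⊢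
    have h1 : algebraMap S (Localization.AtPrime P) (∑ i, g i * x i) ∈
        (P ^ 2).map (algebraMap S (Localization.AtPrime P)) := by
      rw [Ideal.map_pow]
      convert Ideal.mul_mem_left _ (algebraMap S (Localization.AtPrime P) s) hf using 1
      rw [map_sum, Finset.mul_sum]
      refine Finset.sum_congr rfl fun i _ => ?_
      rw [map_mul, hg, Algebra.smul_def, mul_assoc]
    obtain ⟨t, ht, h2⟩ := (IsLocalization.algebraMap_mem_map_algebraMap_iff P.primeCompl _ _ _).mp h1
    have h3 : t * g i ∈ P := by
      refine h.mem_of_sum_mem (fun i => t * g i) ?_ i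
      rw [Finset.mul_sum] at h2
      simpa only [mul_assoc] using h2
    have h4 : g i ∈ P := (Ideal.IsPrime.mem_or_mem ‹_› h3).resolve_left ht
    have h5 := Ideal.mem_map_of_mem (algebraMap S (Localization.AtPrime P)) h4
    rw [hg, Algebra.smul_def] at h5
    exact (Ideal.unit_mul_mem_iff_mem _
      (IsLocalization.map_units (Localization.AtPrime P) s)).mp h5

/-- A conormal basis of `I` is one of the extension of `I` to the polynomial ring. -/
theorem map_C {A ι : Type*} [CommRing A] [Fintype ι] {I : Ideal A} {x : ι → A}
    (h : I.IsConormalBasis x) :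
    (I.map (Polynomial.C : A →+* Polynomial A)).IsConormalBasis
      (fun i => Polynomial.C (x i)) := by
  refine ⟨?_, fun f hf i => ?_⟩
  · conv_rhs => rw [← h.span_eq, Ideal.map_span, ← Set.range_comp]
    rfl
  -- Membership in an extended ideal is tested coefficient by coefficient.
  · rw [← Ideal.map_pow, Ideal.mem_map_C_iff] at hf
    rw [Ideal.mem_map_C_iff]
    intro n
    refine h.mem_of_sum_mem (fun i => (f i).coeff n) ?_ i
    simpa [Polynomial.finsetSum_coeff] using hf n

/-- If `M` is prime and `y ∉ M`, adjoining `y` to a conormal basis of `M` gives one of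
`M ⊔ span {y}`. -/
theorem sup_span_singleton {S ι : Type*} [CommRing S] [Fintype ι] {M : Ideal S} [M.IsPrime]
    {x : ι → S} (h : M.IsConormalBasis x) {y : S} (hy : y ∉ M) :
    (M ⊔ Ideal.span {y}).IsConormalBasis (fun i : Option ι => i.elim y x) := by
  refine ⟨?_, fun f hf => ?_⟩
  · have : Set.range (fun i : Option ι => i.elim y x) = Set.range x ∪ {y} := by
      ext z
      simp [Option.exists, eq_comm]
    rw [this, Ideal.span_union, h.span_eq]
  · rw [Fintype.sum_option] at hf
    simp only [Option.elim_none, Option.elim_some] at hf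
    obtain ⟨a, ha, b, hb, c, hz⟩ : ∃ a ∈ M ^ 2, ∃ b ∈ M, ∃ c,
        f none * y + ∑ i, f (some i) * x i = a + y * b + y * y * c := by
      rw [pow_two, Ideal.sup_mul, Ideal.mul_sup, Ideal.mul_sup] at hf
      obtain ⟨u, hu, v, hv, huv⟩ := Submodule.mem_sup.mp hf
      obtain ⟨u₁, hu₁, u₂, hu₂, rfl⟩ := Submodule.mem_sup.mp hu
      obtain ⟨v₁, hv₁, v₂, hv₂, rfl⟩ := Submodule.mem_sup.mp hv
      obtain ⟨b₁, hb₁, rfl⟩ := Ideal.mem_mul_span_singleton.mp hu₂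
      obtain ⟨b₂, hb₂, rfl⟩ := Ideal.mem_span_singleton_mul.mp hv₁
      rw [Ideal.span_singleton_mul_span_singleton] at hv₂
      obtain ⟨c, rfl⟩ := Ideal.mem_span_singleton'.mp hv₂
      exact ⟨u₁, by rwa [pow_two], b₁ + b₂, M.add_mem hb₁ hb₂, c, by rw [← huv]; ring⟩
    have hsum : ∑ i, f (some i) * x i ∈ M :=
      M.sum_mem fun i _ => M.mul_mem_left _ (h.mem i)
    -- Modulo `M` only the multiples of `y` survive, and `y` cancels because `M` is prime.
    have hm : f none - b - y * c ∈ M := by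
      refine (Ideal.IsPrime.mem_or_mem ‹M.IsPrime› (x := y) ?_).resolve_left hy
      have : y * (f none - b - y * c) = a - ∑ i, f (some i) * x i := by
        linear_combination hz
      rw [this]
      exact M.sub_mem (Ideal.pow_le_self two_ne_zero ha) hsum
    have hyP : ∀ d, y * d ∈ M ⊔ Ideal.span {y} := fun d =>
      Ideal.mul_mem_right _ _ (Ideal.mem_sup_right (Ideal.mem_span_singleton_self y))
    rintro (_ | i)
    · have : f none = (f none - b - y * c) + b + y * c := by ring
      rw [this]
      exact add_mem (Ideal.mem_sup_left (add_mem hm hb)) (hyP c)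
    -- Expanding this element of `M` in the `x i` absorbs the `y` term into the other coefficients,
    -- leaving a relation modulo `M ^ 2`.
    · obtain ⟨g, hg⟩ := Ideal.mem_span_range_iff_exists_fun.mp (h.span_eq.symm ▸ hm :
        f none - b - y * c ∈ Ideal.span (Set.range x))
      have h1 : f (some i) + y * g i ∈ M := by
        refine h.mem_of_sum_mem (fun i => f (some i) + y * g i) ?_ i
        have : ∑ i, (f (some i) + y * g i) * x i = a := by
          simp only [add_mul, Finset.sum_add_distrib, mul_assoc, ← Finset.mul_sum, hg]
          linear_combination hz
        rwa [this]
      have : f (some i) = (f (some i) + y * g i) - y * g i := by ring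
      rw [this]
      exact sub_mem (Ideal.mem_sup_left h1) (hyP _)

end Ideal.IsConormalBasis

/-! ### Invariance of the codimension and regularity -/

theorem localDim_eq_of_ringKrullDim_eq {A : Type*} [CommRing A] [IsLocalRing A]
    [IsNoetherianRing A] {d : ℕ} (h : ringKrullDim A = d) : localDim A = d := by
  rw [← coe_localDim] at h
  exact_mod_cast h

theorem embCodim_eq_of_ringEquiv {A B : Type*} [CommRing A] [CommRing B] [IsLocalRing A]
    [IsLocalRing B] [IsNoetherianRing A] [IsNoetherianRing B] (e : A ≃+* B) :
    embCodim A = embCodim B := by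
  have h1 : embDim A = embDim B := by
    unfold embDim
    rw [← map_ringEquiv_maximalIdeal e, Ideal.spanFinrank_map_eq_of_ringEquiv]
  have h2 : localDim A = localDim B :=
    localDim_eq_of_ringKrullDim_eq (by rw [coe_localDim, ringKrullDim_eq_of_ringEquiv e])
  rw [embCodim, embCodim, h1, h2]

theorem isRegularLocalRing_iff_embCodim_eq_zero {A : Type*} [CommRing A] [IsLocalRing A]
    [IsNoetherianRing A] : IsRegularLocalRing A ↔ embCodim A = 0 := by
  rw [isRegularLocalRing_iff, ← coe_localDim, embCodim, sub_eq_zero, embDim]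
  norm_cast

/-! ### One indeterminate -/

namespace Polynomial

/-- A prime of `A[X]` that strictly contains the extension of the maximal ideal it lies over is
maximal. -/
theorem isMaximal_of_map_C_comap_ne {A : Type*} [CommRing A] (P : Ideal A[X]) [P.IsPrime]
    [hm : (P.comap C).IsMaximal] (hne : P ≠ (P.comap C).map C) : P.IsMaximal := by
  let q := P.comap C
  let _ : Field (A ⧸ q) := Ideal.Quotient.field q
  let φ := mapRingHom (Ideal.Quotient.mk q)
  have hφ : Function.Surjective φ := map_surjective _ Ideal.Quotient.mk_surjective
  have hker : RingHom.ker φ = q.map C := by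
    rw [ker_mapRingHom, Ideal.mk_ker]
  have hle : RingHom.ker φ ≤ P := hker ▸ Ideal.map_comap_le
  have hprime : (P.map φ).IsPrime := Ideal.map_isPrime_of_surjective hφ hle
  have hbot : P.map φ ≠ ⊥ := by
    rw [Ne, Ideal.map_eq_bot_iff_le_ker, hker]
    exact fun h => hne (le_antisymm h Ideal.map_comap_le)
  -- Nonzero primes of the PID `(A ⧸ q)[X]` are maximal.
  have hmax : (P.map φ).IsMaximal := IsPrime.to_maximal_ideal hbot
  have := Ideal.comap_isMaximal_of_surjective φ hφ (K := P.map φ)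
  rwa [Ideal.comap_map_of_surjective' φ hφ, sup_eq_left.mpr hle] at this

theorem embCodim_localization_of_comap_eq_maximalIdeal {A : Type*} [CommRing A] [IsLocalRing A]
    [IsNoetherianRing A] (P : Ideal A[X]) [P.IsPrime] (hP : P.comap C = maximalIdeal A) :
    embCodim (Localization.AtPrime P) = embCodim A := by
  obtain ⟨x, hx⟩ := Ideal.IsConormalBasis.exists_maximalIdeal A
  have hxC := hx.map_C
  have hmax : (P.comap C).IsMaximal := hP ▸ maximalIdeal.isMaximal A
  have hht : ((maximalIdeal A).height : WithBot ℕ∞) = localDim A := by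
    rw [maximalIdeal_height_eq_ringKrullDim, coe_localDim]
  have hdim : ringKrullDim (Localization.AtPrime P) = P.height :=
    IsLocalization.AtPrime.ringKrullDim_eq_height P _
  by_cases hne : P = (P.comap C).map C
  · rw [hP] at hne
    have he : embDim (Localization.AtPrime P) = embDim A := by
      rw [← hne] at hxC
      simpa using hxC.localization_atPrime.embDim_eq_card
    have hd : localDim (Localization.AtPrime P) = localDim A := by
      apply localDim_eq_of_ringKrullDim_eq
      rw [hdim, hne, height_map_C, hht]
    rw [embCodim, embCodim, he, hd]
  · have hPmax := isMaximal_of_map_C_comap_ne P hne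
    obtain ⟨y, -, hy⟩ := exists_monic_span_sup_map_eq A P hmax hne
    rw [hP] at hy hne
    have hprime : ((maximalIdeal A).map (C : A →+* A[X])).IsPrime :=
      (Ideal.isPrime_map_C_iff_isPrime _).mpr inferInstance
    have hyM : y ∉ (maximalIdeal A).map (C : A →+* A[X]) := fun h =>
      hne (by rw [hy, sup_eq_left, Ideal.span_singleton_le_iff_mem]; exact h)
    have he : embDim (Localization.AtPrime P) = embDim A + 1 := by
      have := hxC.sup_span_singleton hyM
      rw [← hy] at this
      simpa using this.localization_atPrime.embDim_eq_card
    have : P.LiesOver (maximalIdeal A) := ⟨hP.symm⟩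
    have hd : localDim (Localization.AtPrime P) = localDim A + 1 := by
      apply localDim_eq_of_ringKrullDim_eq
      rw [hdim, height_eq_height_add_one (maximalIdeal A) P]
      push_cast
      rw [hht]
    rw [embCodim, embCodim, he, hd]
    push_cast
    ring

/-- Inverting the constants outside `q` leaves the local ring at `P` unchanged and makes the
coefficient ring local. -/
theorem embCodim_localization {R : Type*} [CommRing R] [IsNoetherianRing R] (P : Ideal R[X])
    [P.IsPrime] :
    embCodim (Localization.AtPrime P) = embCodim (Localization.AtPrime (P.comap C)) := by
  let q := P.comap C
  let S := (Localization.AtPrime q)[X]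
  let T := Submonoid.map C.toMonoidHom q.primeCompl
  let : Algebra R[X] S := algebra R (Localization.AtPrime q)
  have : IsLocalization T S := isLocalization _ _
  let P' := P.map (algebraMap R[X] S)
  have disj : Disjoint (T : Set R[X]) (P : Set R[X]) := by
    simpa [T, q] using! Set.disjoint_image_left.mpr
      (Set.disjoint_compl_left_iff_subset.mpr (fun _ a ↦ a))
  have : P'.IsPrime := IsLocalization.isPrime_of_isPrime_disjoint T _ _ ‹_› disj
  have : IsLocalization.AtPrime (Localization.AtPrime P') P := by
    convert IsLocalization.isLocalization_isLocalization_atPrime_isLocalization T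
      (Localization.AtPrime P') P'
    exact (IsLocalization.under_map_of_isPrime_disjoint T _ ‹_› disj).symm
  -- An ideal of a localization is determined by its contraction; both sides contract to `q` in `R`.
  have hcomap : P'.comap C = maximalIdeal (Localization.AtPrime q) := by
    rw [← IsLocalization.map_under q.primeCompl _ (P'.comap C),
      ← IsLocalization.map_under q.primeCompl _ (maximalIdeal (Localization.AtPrime q))]
    simp only [Ideal.comap_comap, S, P']
    rw [← algebraMap_eq (R := Localization.AtPrime q),
      ← IsScalarTower.algebraMap_eq R (Localization.AtPrime q) (Localization.AtPrime q)[X],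
      IsScalarTower.algebraMap_eq R R[X] (Localization.AtPrime q)[X], ← Ideal.comap_comap,
      ← Ideal.under_def R[X], IsLocalization.under_map_of_isPrime_disjoint T _ ‹_› disj]
    simp [q, IsLocalization.AtPrime.under_maximalIdeal (Localization.AtPrime q) q]
  rw [← embCodim_localization_of_comap_eq_maximalIdeal P' hcomap]
  exact embCodim_eq_of_ringEquiv (IsLocalization.algEquiv P.primeCompl
    (Localization.AtPrime P) (Localization.AtPrime P')).toRingEquiv

end Polynomial

/-! ### Several indeterminates -/

theorem embCodim_localization_comap_ringEquiv {A B : Type*} [CommRing A] [CommRing B]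
    [IsNoetherianRing A] [IsNoetherianRing B] (e : A ≃+* B) (P : Ideal B) [P.IsPrime] :
    embCodim (Localization.AtPrime (P.comap (e : A →+* B))) =
      embCodim (Localization.AtPrime P) :=
  embCodim_eq_of_ringEquiv (IsLocalization.ringEquivOfRingEquiv
    (Localization.AtPrime (P.comap (e : A →+* B))) (Localization.AtPrime P)
    (M := (P.comap (e : A →+* B)).primeCompl) (T := P.primeCompl) e (e.map_primeCompl_comap_eq P))

theorem embCodim_localization_congr {A : Type*} [CommRing A] [IsNoetherianRing A] {P Q : Ideal A}
    [P.IsPrime] [Q.IsPrime] (h : P = Q) :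
    embCodim (Localization.AtPrime P) = embCodim (Localization.AtPrime Q) := by
  subst h
  rfl

theorem MvPolynomial.embCodim_localization {R : Type*} [CommRing R] [IsNoetherianRing R] (n : ℕ)
    (P : Ideal (MvPolynomial (Fin n) R)) [P.IsPrime] :
    embCodim (Localization.AtPrime P) =
      embCodim (Localization.AtPrime (P.comap (C : R →+* MvPolynomial (Fin n) R))) := by
  induction n with
  | zero =>
    rw [← embCodim_localization_comap_ringEquiv (isEmptyRingEquiv R (Fin 0)).symm P]
    refine embCodim_localization_congr (congrArg (fun f => P.comap f) ?_)
    ext r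
    simp
  | succ n ih =>
    rw [← embCodim_localization_comap_ringEquiv (finSuccEquiv R n).toRingEquiv.symm P,
      Polynomial.embCodim_localization, ih]
    refine embCodim_localization_congr ?_
    rw [Ideal.comap_comap, Ideal.comap_comap]
    refine congrArg (fun f => P.comap f) (RingHom.ext fun r => ?_)
    refine (finSuccEquiv R n).toRingEquiv.symm_apply_eq.mpr ?_
    simp [finSuccEquiv_apply]

theorem corollary3p2 (R : Type*) [CommRing R] [IsNoetherianRing R] (n : ℕ) :
    (∀ (P : Ideal (MvPolynomial (Fin n) R)) [P.IsPrime],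
      embCodim (Localization.AtPrime P) =
        embCodim (Localization.AtPrime
          (P.comap (MvPolynomial.C : R →+* MvPolynomial (Fin n) R)))) ∧
    (IsRegularRing (MvPolynomial (Fin n) R) ↔ IsRegularRing R) := by
  refine ⟨fun P _ => MvPolynomial.embCodim_localization n P, ?_⟩
  simp only [isRegularRing_iff, isRegularLocalRing_iff_embCodim_eq_zero]
  refine ⟨fun h p hp => ?_, fun h P hP => ?_⟩
  -- Every prime `p` of `R` is a contraction: take the polynomials with constant term in `p`.
  · have hcomap : (p.comap (MvPolynomial.constantCoeff : MvPolynomial (Fin n) R →+* R)).comap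
        MvPolynomial.C = p := by
      ext r
      simp
    rw [← embCodim_localization_congr hcomap, ← MvPolynomial.embCodim_localization]
    exact h _
  · rw [MvPolynomial.embCodim_localization]
    exact h _
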